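/- For a finite graph $G$ and an integer $p\ge 2$, let $\alpha_p(G)$ denote the maximum size of a set $U\subseteq V(G)$ such that $G[U]$ contains no copy of $K_p$. For nonempty disjoint $X,Y\subseteq V(G)$ let $d(X,Y)=\frac{e(X,Y)}{|X||Y|}$, where $e(X,Y)$ is the number of edges between $X$ and $Y$; for $\varepsilon,d>0$, the pair $(X,Y)$ is called $(\varepsilon,d)$-regular if $d(X,Y)\ge d$ and $|d(X',Y')-d(X,Y)|\le\varepsilon$ for all $X'\subseteq X$, $Y'\subseteq Y$ with $|X'|\ge\varepsilon|X|$ and $|Y'|\ge\varepsilon|Y|$. Lemma. Let $d>0$ be a real number and let $p,q\ge 2$ be integers. There exist $C,\varepsilon>0$ (depending only on $d,p,q$) such that for every $\eta>0$ there is $n_0$ such that the following holds for every integer $n\ge n_0$, with $g(n):=n^{1-C(\log n)^{-1/q}}$. Let $G$ be an $n$-vertex graph with $\alpha_p(G)<g(n)$, and let $V_1,\dots,V_q\subseteq V(G)$ be pairwise disjoint sets with $|V_i|\ge\eta n$ for every $i\in\{1,\dots,q\}$ such that every pair $(V_i,V_j)$ with $i\ne j$ is $(\varepsilon,d)$-regular.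 Then $G$ contains a copy of $K_{pq}$ that has exactly $p$ vertices in each $V_i$, $1\le i\le q$. -/

import Mathlib

namespace SimpleGraph

/-- The `p`-independence number `α_p(G)`: the largest size of a set of vertices of the
finite graph `G` whose induced subgraph contains no clique on `p` vertices. -/
noncomputable def cliqueIndepNum {V : Type*} [Fintype V] (G : SimpleGraph V) (p : ℕ) : ℕ :=
  sSup {k : ℕ | ∃ U : Finset V, G.CliqueFreeOn (U : Set V) p ∧ U.card = k}

open Classical in
/-- The density `d(X, Y) = e(X, Y) / (|X| |Y|)` as a real number. -/
noncomputable def realDensity {V : Type*} (G : SimpleGraph V) (X Y : Finset V) : ℝ :=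
  (G.edgeDensity X Y : ℝ)

/-- The pair `(X, Y)` is `(ε, d)`-regular: it is `ε`-regular (with the non-strict inequality)
and has density at least `d`. -/
def IsRegularPair {V : Type*} (G : SimpleGraph V) (ε d : ℝ) (X Y : Finset V) : Prop :=
  d ≤ G.realDensity X Y ∧
    ∀ X' ⊆ X, ∀ Y' ⊆ Y, ε * (X.card : ℝ) ≤ (X'.card : ℝ) → ε * (Y.card : ℝ) ≤ (Y'.card : ℝ) →
      |G.realDensity X' Y' - G.realDensity X Y| ≤ ε

end SimpleGraph

/-! Regularity makes the transversal `K_q`'s a `q`-partite `q`-graph of constant density `c`. It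
remains to find in it a complete `q`-partite subgraph each of whose parts is a `K_p` of `G`. The
parts are treated one at a time. Dependent random choice on a part leaves at least `g(n)` vertices,
any `p` of which have a dense common link in the remaining parts. Since `α_p(G) < g(n)`, they
contain a `K_p`, and the argument continues inside its common link. With `L = log n`, `k` remaining
parts need density `exp (-x k)`, where `x k` is of order `L ^ (1 - k/q)`; a round ending with `j`
remaining parts samples about `L ^ (j/q)` points. The product of samples and `x j` has order `L`,
enough to beat the `n ^ p` candidate `p`-sets, while the part shrinks only by `exp (-O(L ^ (1 -
1/q)))`, which is the shape of `g(n) / n`. -/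

/-! ### Dependent random choice, single and iterated -/

open Finset in
/-- Dependent random choice for a dense relation between finite sets. -/
theorem exists_subset_card_common_ge {α β : Type*} (A : Finset α) (B : Finset β)
    (R : α → β → Prop) [∀ a, DecidablePred (R a)] (p t : ℕ) {δ δ' : ℝ} (hδ : 0 < δ)
    (hδ' : 0 ≤ δ') (hA : A.Nonempty) (hB : B.Nonempty)
    (hdens : δ * #A * #B ≤ ∑ a ∈ A, (#{b ∈ B | R a b} : ℝ))
    (hpow : (#A : ℝ) ^ p * δ' ^ t ≤ δ ^ t / 2) :
    ∃ A' ⊆ A, δ ^ t / 2 * #A ≤ (#A' : ℝ) ∧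
      ∀ S ⊆ A', #S = p → δ' * #B ≤ (#{b ∈ B | ∀ a ∈ S, R a b} : ℝ) := by
  classical
  have hA0 : (0 : ℝ) < #A := by exact_mod_cast hA.card_pos
  have hB0 : (0 : ℝ) < #B := by exact_mod_cast hB.card_pos
  -- Sample `t` points of `B` with repetition; `N T` is the common neighbourhood of the sample.
  let P : Finset (Fin t → β) := Fintype.piFinset fun _ => B
  have hPcard : (#P : ℝ) = (#B : ℝ) ^ t := by simp [P]
  have hP0 : P.Nonempty := by
    rw [← card_pos, ← Nat.cast_pos (α := ℝ), hPcard]; positivity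
  let N : (Fin t → β) → Finset α := fun T => {a ∈ A | ∀ i, R a (T i)}
  let bad : Finset (Finset α) :=
    {S ∈ powersetCard p A | (#{b ∈ B | ∀ a ∈ S, R a b} : ℝ) < δ' * #B}
  have hsumN : (#A : ℝ) * (δ * #B) ^ t ≤ ∑ T ∈ P, (#(N T) : ℝ) := by
    have h1 : ∑ T ∈ P, (#(N T) : ℝ) = ∑ a ∈ A, (#{b ∈ B | R a b} : ℝ) ^ t := by
      have h2 := sum_card_bipartiteAbove_eq_sum_card_bipartiteBelow (s := A) (t := P)
        (fun a T => ∀ i, R a (T i))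
      have h3 : ∀ a ∈ A, #(P.bipartiteAbove (fun a T => ∀ i, R a (T i)) a)
          = #{b ∈ B | R a b} ^ t := by
        intro a _
        have : P.bipartiteAbove (fun a T => ∀ i, R a (T i)) a
            = Fintype.piFinset fun _ : Fin t => {b ∈ B | R a b} := by
          ext T
          simp [P, bipartiteAbove, Fintype.mem_piFinset, forall_and]
        rw [this]; simp
      rw [sum_congr rfl h3] at h2
      have h4 : ∑ T ∈ P, #(N T) = ∑ a ∈ A, #{b ∈ B | R a b} ^ t := h2.symm
      exact_mod_cast h4
    rw [h1]
    -- Convexity: at fixed average degree, the sum of `t`-th powers is least when degrees are equal.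
    have h5 := Real.pow_arith_mean_le_arith_mean_pow A (fun _ => (#A : ℝ)⁻¹)
      (fun a => (#{b ∈ B | R a b} : ℝ)) (fun _ _ => by positivity)
      (by rw [sum_const, nsmul_eq_mul, mul_inv_cancel₀ hA0.ne']) (fun _ _ => by positivity) t
    rw [← mul_sum, ← mul_sum, inv_mul_eq_div, inv_mul_eq_div, le_div_iff₀ hA0] at h5
    have h6 : δ * #B ≤ (∑ a ∈ A, (#{b ∈ B | R a b} : ℝ)) / #A := by
      rw [le_div_iff₀ hA0]
      linarith
    calc (#A : ℝ) * (δ * #B) ^ t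
        ≤ #A * ((∑ a ∈ A, (#{b ∈ B | R a b} : ℝ)) / #A) ^ t := by gcongr
      _ ≤ _ := by linarith
  have hsumbad : ∑ T ∈ P, (#{S ∈ bad | S ⊆ N T} : ℝ) ≤ (#A : ℝ) ^ p * (δ' * #B) ^ t := by
    have h2 := sum_card_bipartiteAbove_eq_sum_card_bipartiteBelow (s := bad) (t := P)
      (fun S T => S ⊆ N T)
    have h3 : ∀ S ∈ bad, (#(P.bipartiteAbove (fun S T => S ⊆ N T) S) : ℝ) ≤ (δ' * #B) ^ t := by
      intro S hS
      simp only [bad, mem_filter, mem_powersetCard] at hS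
      have : P.bipartiteAbove (fun S T => S ⊆ N T) S
          = Fintype.piFinset fun _ : Fin t => {b ∈ B | ∀ a ∈ S, R a b} := by
        ext T
        simp only [P, N, bipartiteAbove, mem_filter, Fintype.mem_piFinset, subset_iff]
        constructor
        · exact fun h i => ⟨h.1 i, fun a ha => (h.2 ha).2 i⟩
        · exact fun h => ⟨fun i => (h i).1, fun a ha => ⟨hS.1.1 ha, fun i => (h i).2 a ha⟩⟩
      rw [this]
      simp only [Fintype.card_piFinset, prod_const, card_univ, Fintype.card_fin, Nat.cast_pow]
      exact pow_le_pow_left₀ (Nat.cast_nonneg _) hS.2.le _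
    have h4 : ∑ T ∈ P, (#{S ∈ bad | S ⊆ N T} : ℝ)
        = ∑ S ∈ bad, (#(P.bipartiteAbove (fun S T => S ⊆ N T) S) : ℝ) := by
      exact_mod_cast h2.symm
    have h5 : (#bad : ℝ) ≤ (#A : ℝ) ^ p := by
      have : #bad ≤ #A ^ p :=
        (card_filter_le _ _).trans (by rw [card_powersetCard]; exact Nat.choose_le_pow _ _)
      exact_mod_cast this
    rw [h4]
    refine (sum_le_sum h3).trans ?_
    rw [sum_const, nsmul_eq_mul]
    gcongr
  -- Average `#(N T) - #A * #bad(T)`: the weight `#A` makes a sample with any bad set worthless, so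
  -- no vertices need deleting.
  obtain ⟨T, -, hbad, hcard⟩ :
      ∃ T ∈ P, #{S ∈ bad | S ⊆ N T} = 0 ∧ δ ^ t / 2 * #A ≤ (#(N T) : ℝ) := by
    by_contra! hcon
    have hlt : ∀ T ∈ P, (#(N T) : ℝ) < δ ^ t / 2 * #A + #A * #{S ∈ bad | S ⊆ N T} := by
      intro T hT
      rcases Nat.eq_zero_or_pos #{S ∈ bad | S ⊆ N T} with h0 | h0
      · rw [h0]; simpa using hcon T hT h0
      · have h1 : (1 : ℝ) ≤ #{S ∈ bad | S ⊆ N T} := by exact_mod_cast h0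
        have h2 : (#(N T) : ℝ) ≤ #A := by exact_mod_cast card_filter_le _ _
        have h3 : 0 < δ ^ t / 2 * #A := by positivity
        nlinarith
    have hsum := sum_lt_sum_of_nonempty hP0 hlt
    rw [sum_add_distrib, sum_const, nsmul_eq_mul, hPcard, ← mul_sum] at hsum
    have h1 := mul_le_mul_of_nonneg_left hsumbad hA0.le
    have h2 : (#A : ℝ) * ((#A : ℝ) ^ p * (δ' * #B) ^ t) ≤ #A * (δ ^ t / 2 * #B ^ t) := by
      rw [mul_pow, ← mul_assoc ((#A : ℝ) ^ p)]
      gcongr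
    rw [mul_pow] at hsumN
    nlinarith
  refine ⟨N T, filter_subset _ _, hcard, fun S hS hSp => ?_⟩
  by_contra! hlt
  have : S ∈ ({S ∈ bad | S ⊆ N T} : Finset _) := by
    simp only [bad, mem_filter, mem_powersetCard]
    exact ⟨⟨⟨hS.trans (filter_subset _ _), hSp⟩, hlt⟩, hS⟩
  rw [card_eq_zero] at hbad
  simp [hbad] at this

open Finset in
/-- Iterated dependent random choice: a `k`-partite `k`-uniform hypergraph that is dense enough
contains a complete `k`-partite subhypergraph whose parts are `p`-sets satisfying `K`, provided
that every set of at least `m` vertices contains such a `p`-set. -/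
theorem exists_piFinset_subset {V : Type*} [DecidableEq V] (K : Finset V → Prop) (p : ℕ)
    (m : ℝ) (hK : ∀ A : Finset V, m ≤ #A → ∃ S ⊆ A, #S = p ∧ K S)
    (δ : ℕ → ℝ) (hδ : ∀ k, 0 < δ k) (t : ℕ → ℕ) (k : ℕ) (U : Fin k → Finset V)
    (hU : ∀ i, (U i).Nonempty)
    (hpow : ∀ i, ∀ j < k, (#(U i) : ℝ) ^ p * δ j ^ t j ≤ δ (j + 1) ^ t j / 2)
    (hm : ∀ i, ∀ j < k, m ≤ δ (j + 1) ^ t j / 2 * #(U i))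
    (F : Finset (Fin k → V)) (hF : F ⊆ Fintype.piFinset U) (hdens : δ k * ∏ i, (#(U i) : ℝ) ≤ #F) :
    ∃ S : Fin k → Finset V, (∀ i, S i ⊆ U i ∧ #(S i) = p ∧ K (S i)) ∧ Fintype.piFinset S ⊆ F := by
  induction k with
  | zero =>
    refine ⟨U, fun i => i.elim0, ?_⟩
    have h : 0 < #F := by
      have := hδ 0
      simp only [univ_eq_empty, prod_empty, mul_one] at hdens
      exact_mod_cast this.trans_le hdens
    obtain ⟨f, hf⟩ := card_pos.1 h
    intro g _
    rwa [Subsingleton.elim g f]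
  | succ k ih =>
    have hcount : (∑ a ∈ U 0, (#{g ∈ Fintype.piFinset (Fin.tail U) | Fin.cons a g ∈ F} : ℝ)) = #F := by
      have h1 : #F = ∑ a ∈ U 0, #{f ∈ F | f 0 = a} :=
        card_eq_sum_card_fiberwise fun f hf => Fintype.mem_piFinset.1 (hF hf) 0
      rw [h1, Nat.cast_sum]
      refine sum_congr rfl fun a _ => ?_
      congr 1
      refine card_bij' (fun g _ => Fin.cons a g) (fun f _ => Fin.tail f) ?_ ?_ ?_ ?_
      · intro g hg
        simp only [mem_filter] at hg ⊢
        exact ⟨hg.2, rfl⟩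
      · intro f hf
        simp only [mem_filter] at hf ⊢
        obtain ⟨hf, rfl⟩ := hf
        refine ⟨Fintype.mem_piFinset.2 fun i => Fintype.mem_piFinset.1 (hF hf) i.succ, ?_⟩
        rwa [Fin.cons_self_tail]
      · intro g _; exact Fin.tail_cons _ _
      · intro f hf
        simp only [mem_filter] at hf
        rw [← hf.2, Fin.cons_self_tail]
    have hB : (Fintype.piFinset (Fin.tail U)).Nonempty :=
      Fintype.piFinset_nonempty.2 fun i => hU i.succ
    have hBcard : (#(Fintype.piFinset (Fin.tail U)) : ℝ) = ∏ i, (#(Fin.tail U i) : ℝ) := by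
      simp [Fintype.card_piFinset]
    obtain ⟨A, hAU, hA, hcommon⟩ := exists_subset_card_common_ge (U 0)
      (Fintype.piFinset (Fin.tail U)) (fun a g => (Fin.cons a g : Fin (k + 1) → V) ∈ F) p (t k)
      (hδ (k + 1)) (hδ k).le (hU 0) hB
      (by
        rw [hcount, hBcard]
        refine le_trans (le_of_eq ?_) hdens
        rw [Fin.prod_univ_succ, mul_assoc]; rfl)
      (hpow 0 k k.lt_succ_self)
    obtain ⟨S₀, hS₀A, hS₀p, hS₀K⟩ := hK A ((hm 0 k k.lt_succ_self).trans hA)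
    -- Recurse in the common link of `S₀`, whose density is at least `δ k`.
    obtain ⟨S, hS, hSF⟩ := ih (Fin.tail U) (fun i => hU i.succ)
      (fun i j hj => hpow i.succ j (hj.trans k.lt_succ_self))
      (fun i j hj => hm i.succ j (hj.trans k.lt_succ_self))
      {g ∈ Fintype.piFinset (Fin.tail U) | ∀ a ∈ S₀, (Fin.cons a g : Fin (k + 1) → V) ∈ F}
      (filter_subset _ _)
      (by rw [← hBcard]; exact hcommon S₀ hS₀A hS₀p)
    refine ⟨Fin.cons S₀ S, fun i => ?_, fun f hf => ?_⟩
    · refine Fin.cases ?_ (fun i => ?_) i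
      · exact ⟨hS₀A.trans hAU, hS₀p, hS₀K⟩
      · exact hS i
    · rw [Fintype.mem_piFinset] at hf
      have h1 : Fin.tail f ∈ Fintype.piFinset S :=
        Fintype.mem_piFinset.2 fun i => hf i.succ
      have h2 := (mem_filter.1 (hSF h1)).2 (f 0) (hf 0)
      rwa [Fin.cons_self_tail] at h2

/-! ### Regular pairs, transversal cliques and gluing -/

namespace SimpleGraph

open Finset in
/-- A pair of vertex sets is lower regular if every pair of large subsets spans many edges. -/
def IsLowerRegular {V : Type*} (G : SimpleGraph V) [DecidableRel G.Adj] (ε d : ℝ)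
    (X Y : Finset V) : Prop :=
  ∀ X' ⊆ X, ∀ Y' ⊆ Y, ε * (#X : ℝ) ≤ (#X' : ℝ) → ε * (#Y : ℝ) ≤ (#Y' : ℝ) →
    d * #X' * #Y' ≤ ∑ x ∈ X', (#{y ∈ Y' | G.Adj x y} : ℝ)

open Finset in
theorem IsRegularPair.isLowerRegular {V : Type*} {G : SimpleGraph V} [DecidableRel G.Adj]
    {ε d : ℝ} {X Y : Finset V} (h : G.IsRegularPair ε d X Y) :
    G.IsLowerRegular ε (d - ε) X Y := by
  intro X' hX Y' hY hX' hY'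
  have h1 : d - ε ≤ G.realDensity X' Y' := by
    have := abs_le.1 (h.2 X' hX Y' hY hX' hY')
    linarith [h.1]
  have h2 : ∑ x ∈ X', (#{y ∈ Y' | G.Adj x y} : ℝ) = G.realDensity X' Y' * (#X' * #Y') := by
    classical
    rcases X'.eq_empty_or_nonempty with rfl | hXn
    · simp
    rcases Y'.eq_empty_or_nonempty with rfl | hYn
    · simp
    have hX0 : (0 : ℝ) < #X' := by exact_mod_cast hXn.card_pos
    have hY0 : (0 : ℝ) < #Y' := by exact_mod_cast hYn.card_pos
    have h3 : ∑ x ∈ X', #{y ∈ Y' | G.Adj x y} = #(G.interedges X' Y') := by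
      unfold interedges Rel.interedges
      rw [card_filter, sum_product]
      simp_rw [card_filter]
    rw [realDensity, edgeDensity_def]
    push_cast
    rw [div_mul_cancel₀ _ (by positivity)]
    rw [← Nat.cast_sum, h3]
    congr!
  rw [h2, mul_assoc]
  gcongr

-- Subsets keeping a share `γ` inherit regularity at the cost of a factor `1/γ` in `ε`; used for
-- neighbourhoods, with `γ = d`.
open Finset in
theorem IsLowerRegular.mono {V : Type*} {G : SimpleGraph V} [DecidableRel G.Adj]
    {ε ε' γ d : ℝ} {X Y X₁ Y₁ : Finset V} (h : G.IsLowerRegular ε d X Y)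
    (hε' : 0 ≤ ε') (hε : ε ≤ ε' * γ) (hX : X₁ ⊆ X) (hY : Y₁ ⊆ Y) (hXγ : γ * #X ≤ (#X₁ : ℝ))
    (hYγ : γ * #Y ≤ (#Y₁ : ℝ)) : G.IsLowerRegular ε' d X₁ Y₁ := by
  intro X' hX' Y' hY' h1 h2
  refine h X' (hX'.trans hX) Y' (hY'.trans hY) (le_trans ?_ h1) (le_trans ?_ h2)
  · calc ε * (#X : ℝ) ≤ ε' * γ * #X := by gcongr
      _ = ε' * (γ * #X) := by ring
      _ ≤ _ := by gcongr
  · calc ε * (#Y : ℝ) ≤ ε' * γ * #Y := by gcongr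
      _ = ε' * (γ * #Y) := by ring
      _ ≤ _ := by gcongr

open Finset in
/-- In a lower regular pair, few vertices have small degree to the other side. -/
theorem IsLowerRegular.card_low_degree_le {V : Type*} {G : SimpleGraph V} [DecidableRel G.Adj]
    {ε d : ℝ} {X Y : Finset V} (h : G.IsLowerRegular ε d X Y) (hε : ε ≤ 1) (hε0 : 0 ≤ ε) :
    (#{x ∈ X | (#{y ∈ Y | G.Adj x y} : ℝ) < d * #Y} : ℝ) ≤ ε * #X := by
  by_contra! hcon
  set Z := {x ∈ X | (#{y ∈ Y | G.Adj x y} : ℝ) < d * #Y} with hZ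
  have hZ0 : Z.Nonempty := by
    rw [← card_pos, ← Nat.cast_pos (α := ℝ)]
    exact lt_of_le_of_lt (by positivity) hcon
  have h1 := h Z (filter_subset _ _) Y subset_rfl hcon.le
    (mul_le_of_le_one_left (Nat.cast_nonneg _) hε)
  have h2 : ∑ x ∈ Z, (#{y ∈ Y | G.Adj x y} : ℝ) < ∑ x ∈ Z, d * #Y :=
    sum_lt_sum_of_nonempty hZ0 fun x hx => (mem_filter.1 hx).2
  rw [sum_const, nsmul_eq_mul] at h2
  linarith

open Finset in
/-- Counting lemma: a tuple of pairwise lower regular sets spans a positive proportion of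
transversal cliques. -/
theorem exists_card_transversal_cliques_ge (d : ℝ) (hd : 0 < d) (q : ℕ) :
    ∃ ε c : ℝ, 0 < ε ∧ 0 < c ∧ ∀ (V : Type*) [DecidableEq V] (G : SimpleGraph V)
      [DecidableRel G.Adj] (U : Fin q → Finset V),
      (∀ i j, i ≠ j → G.IsLowerRegular ε d (U i) (U j)) →
      c * ∏ i, (#(U i) : ℝ) ≤
        #{f ∈ Fintype.piFinset U | ∀ i j, i ≠ j → G.Adj (f i) (f j)} := by
  induction q with
  | zero =>
    refine ⟨1, 1, one_pos, one_pos, fun V _ G _ U _ => ?_⟩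
    simp
  | succ q ih =>
    obtain ⟨ε', c', hε', hc', ih⟩ := ih
    -- `ε' * d` lets neighbourhoods inherit `ε'`; the other bound keeps at least half of `U 0` of
    -- high degree to every other part.
    refine ⟨min (ε' * d) (1 / (2 * (q + 1))), c' * d ^ q / 2, by positivity, by positivity,
      fun V _ G _ U hU => ?_⟩
    set ε := min (ε' * d) (1 / (2 * (q + 1))) with hε
    have hε0 : 0 < ε := by positivity
    have hεq : ε * (q + 1) ≤ 1 / 2 := by
      have : ε ≤ 1 / (2 * (q + 1)) := min_le_right _ _
      calc ε * (q + 1) ≤ 1 / (2 * (q + 1)) * (q + 1) := by gcongr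
        _ = 1 / 2 := by field_simp
    have hε1 : ε ≤ 1 := by
      have : 0 ≤ ε * q := by positivity
      linarith
    let N : V → Fin q → Finset V := fun v i => {y ∈ U i.succ | G.Adj v y}
    let low : Fin q → Finset V := fun i => {v ∈ U 0 | (#(N v i) : ℝ) < d * #(U i.succ)}
    let good : Finset V := U 0 \ univ.biUnion low
    have hgood : (#(U 0) : ℝ) / 2 ≤ #good := by
      have h1 : ∀ i, (#(low i) : ℝ) ≤ ε * #(U 0) := fun i =>
        (hU 0 i.succ (Fin.succ_ne_zero i).symm).card_low_degree_le hε1 hε0.le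
      have h2 : (#(univ.biUnion low) : ℝ) ≤ q * (ε * #(U 0)) := by
        calc (#(univ.biUnion low) : ℝ) ≤ ∑ i, (#(low i) : ℝ) := by
              exact_mod_cast card_biUnion_le
          _ ≤ ∑ _i : Fin q, ε * #(U 0) := sum_le_sum fun i _ => h1 i
          _ = _ := by simp
      have h3 : (#(U 0) : ℝ) ≤ #(univ.biUnion low) + #good := by
        have := card_le_card_sdiff_add_card (s := U 0) (t := univ.biUnion low)
        have h4 : #(U 0) ≤ #(univ.biUnion low) + #good := by
          simp only [good]; omega
        exact_mod_cast h4
      have h5 : (0 : ℝ) ≤ #(U 0) := Nat.cast_nonneg _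
      nlinarith
    have hlink : ∀ v ∈ good, c' * d ^ q * ∏ i : Fin q, (#(U i.succ) : ℝ) ≤
        #{g ∈ Fintype.piFinset (N v) | ∀ i j, i ≠ j → G.Adj (g i) (g j)} := by
      intro v hv
      simp only [good, low, mem_sdiff, mem_biUnion, mem_univ, true_and, mem_filter, not_exists,
        not_and, not_lt] at hv
      have hdeg : ∀ i, d * #(U i.succ) ≤ (#(N v i) : ℝ) := fun i => hv.2 i hv.1
      refine le_trans ?_ (ih V G (N v) fun i j hij =>
        (hU i.succ j.succ (by simpa using hij)).mono hε'.le (min_le_left _ _)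
          (filter_subset _ _) (filter_subset _ _) (hdeg i) (hdeg j))
      rw [mul_assoc]
      gcongr
      calc d ^ q * ∏ i : Fin q, (#(U i.succ) : ℝ) = ∏ i : Fin q, d * (#(U i.succ) : ℝ) := by
            rw [prod_mul_distrib]; simp
        _ ≤ _ := prod_le_prod (fun i _ => by positivity) fun i _ => hdeg i
    have hinj : (∑ v ∈ good, #{g ∈ Fintype.piFinset (N v) | ∀ i j, i ≠ j → G.Adj (g i) (g j)}) ≤
        #{f ∈ Fintype.piFinset U | ∀ i j, i ≠ j → G.Adj (f i) (f j)} := by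
      rw [← card_sigma]
      refine card_le_card_of_injOn (fun x => Fin.cons x.1 x.2) ?_ ?_
      · rintro ⟨v, g⟩ hx
        simp only [coe_sigma, Set.mem_sigma_iff, mem_coe, mem_filter, Fintype.mem_piFinset, N] at hx
        obtain ⟨hv, hg, hadj⟩ := hx
        simp only [mem_coe, mem_filter, Fintype.mem_piFinset]
        refine ⟨fun i => ?_, fun i j hij => ?_⟩
        · refine Fin.cases ?_ (fun i => ?_) i
          · exact (mem_sdiff.1 hv).1
          · exact (hg i).1
        · induction i using Fin.cases with
          | zero =>
            induction j using Fin.cases with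
            | zero => exact absurd rfl hij
            | succ j => exact (hg j).2
          | succ i =>
            induction j using Fin.cases with
            | zero => exact (hg i).2.symm
            | succ j => exact hadj i j (by simpa using hij)
      · rintro ⟨v, g⟩ _ ⟨w, h⟩ _ hvw
        obtain ⟨rfl, rfl⟩ := Fin.cons_injective2 hvw
        rfl
    calc c' * d ^ q / 2 * ∏ i, (#(U i) : ℝ)
        = #(U 0) / 2 * (c' * d ^ q * ∏ i : Fin q, (#(U i.succ) : ℝ)) := by
          rw [Fin.prod_univ_succ]; ring
      _ ≤ #good * (c' * d ^ q * ∏ i : Fin q, (#(U i.succ) : ℝ)) :=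
          mul_le_mul_of_nonneg_right hgood (mul_nonneg (by positivity)
            (prod_nonneg fun i _ => Nat.cast_nonneg _))
      _ = ∑ v ∈ good, c' * d ^ q * ∏ i : Fin q, (#(U i.succ) : ℝ) := by
          rw [sum_const, nsmul_eq_mul]
      _ ≤ ∑ v ∈ good, (#{g ∈ Fintype.piFinset (N v) | ∀ i j, i ≠ j → G.Adj (g i) (g j)} : ℝ) :=
          sum_le_sum hlink
      _ ≤ _ := by exact_mod_cast hinj

open Finset in
/-- A vertex set larger than the `p`-independence number contains a `p`-clique. -/
theorem exists_isNClique_of_cliqueIndepNum_lt {V : Type*} [Fintype V] (G : SimpleGraph V)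
    {p : ℕ} {A : Finset V} (hA : G.cliqueIndepNum p < #A) : ∃ S ⊆ A, G.IsNClique p S := by
  by_contra! hcon
  refine hA.not_ge (le_csSup ⟨Fintype.card V, ?_⟩ ⟨A, fun S hS => ?_, rfl⟩)
  · rintro k ⟨U, -, rfl⟩
    exact card_le_univ U
  · exact hcon S (by exact_mod_cast hS)

open Finset in
/-- Transversally complete cliques of size `p` combine to one clique. -/
theorem isNClique_biUnion_of_piFinset {V : Type*} [DecidableEq V] (G : SimpleGraph V)
    {p q : ℕ} (hp : 0 < p) {S : Fin q → Finset V} (hS : ∀ i, G.IsNClique p (S i))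
    (hdisj : ∀ i j, i ≠ j → Disjoint (S i) (S j))
    (hadj : ∀ f ∈ Fintype.piFinset S, ∀ i j, i ≠ j → G.Adj (f i) (f j)) :
    G.IsNClique (p * q) (univ.biUnion S) := by
  have hne : ∀ i, (S i).Nonempty := fun i => card_pos.1 (by rw [(hS i).card_eq]; exact hp)
  choose f₀ hf₀ using hne
  refine ⟨fun u hu v hv huv => ?_, ?_⟩
  · simp only [coe_biUnion, Set.mem_iUnion, mem_coe, mem_univ, exists_prop, true_and] at hu hv
    obtain ⟨i, hi⟩ := hu
    obtain ⟨j, hj⟩ := hv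
    by_cases hij : i = j
    · subst hij
      exact (hS i).isClique hi hj huv
    -- Reroute `f₀` through `u` and `v` to get a transversal containing both.
    · have h := hadj (Function.update (Function.update f₀ i u) j v) (Fintype.mem_piFinset.2
        fun l => by
          by_cases hl : l = j
          · subst hl; simpa using hj
          · rw [Function.update_of_ne hl]
            by_cases hl' : l = i
            · subst hl'; simpa using hi
            · rw [Function.update_of_ne hl']; exact hf₀ l) i j hij
      simpa [Function.update_of_ne hij] using h
  · rw [card_biUnion fun i _ j _ hij => hdisj i j hij]
    simp [(hS _).card_eq, mul_comm]

end SimpleGraph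

/-! ### Choice of parameters and assembly -/

/-- The parameters for the iterated dependent random choice: with `L = log n`, the densities
`exp (-(κ + (q - k) (p + 1)) L ^ (1 - k / q))` and the numbers of samples `⌈L ^ (j / q)⌉`. -/
theorem drc_parameters (κ : ℝ) (hκ : 0 ≤ κ) (p q : ℕ) (hq : 0 < q) {L : ℝ} (hL : 1 ≤ L) {j : ℕ}
    (hj : j < q) :
    (⌈L ^ ((j : ℝ) / q)⌉₊ : ℝ) * ((κ + ((q : ℝ) - (j + 1 : ℕ)) * (p + 1)) *
        L ^ (1 - ((j + 1 : ℕ) : ℝ) / q)) ≤ 2 * (κ + q * (p + 1)) * L ^ (1 - 1 / (q : ℝ)) ∧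
      p * L + Real.log 2 + (⌈L ^ ((j : ℝ) / q)⌉₊ : ℝ) * ((κ + ((q : ℝ) - (j + 1 : ℕ)) * (p + 1)) *
        L ^ (1 - ((j + 1 : ℕ) : ℝ) / q)) ≤ (⌈L ^ ((j : ℝ) / q)⌉₊ : ℝ) *
          ((κ + ((q : ℝ) - j) * (p + 1)) * L ^ (1 - (j : ℝ) / q)) := by
  have hL0 : 0 < L := by linarith
  have hq0 : (0 : ℝ) < q := by exact_mod_cast hq
  have hjq : ((j + 1 : ℕ) : ℝ) ≤ q := by exact_mod_cast hj
  set T : ℝ := (⌈L ^ ((j : ℝ) / q)⌉₊ : ℝ) with hT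
  have h1 : 1 ≤ L ^ ((j : ℝ) / q) := Real.one_le_rpow hL (by positivity)
  have hTl : L ^ ((j : ℝ) / q) ≤ T := Nat.le_ceil _
  have hTu : T ≤ 2 * L ^ ((j : ℝ) / q) := by
    have := Nat.ceil_lt_add_one (a := L ^ ((j : ℝ) / q)) (by positivity)
    linarith
  set y := L ^ (1 - ((j + 1 : ℕ) : ℝ) / q) with hy
  set z := L ^ (1 - (j : ℝ) / q) with hz
  have hy0 : 0 < y := by positivity
  have hz0 : 0 < z := by positivity
  have hyz : y ≤ z := by
    refine Real.rpow_le_rpow_of_exponent_le hL ?_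
    gcongr
    exact_mod_cast Nat.le_succ j
  have hTz : L ≤ T * z := by
    calc L = L ^ ((j : ℝ) / q) * z := by
          rw [hz, ← Real.rpow_add hL0]; simp
      _ ≤ T * z := by gcongr
  have hTy : T * y ≤ 2 * L ^ (1 - 1 / (q : ℝ)) := by
    calc T * y ≤ 2 * L ^ ((j : ℝ) / q) * y := by gcongr
      _ = 2 * L ^ (1 - 1 / (q : ℝ)) := by
        rw [hy, mul_assoc, ← Real.rpow_add hL0]
        congr 2
        push_cast
        field_simp
        ring
  have hlog : Real.log 2 ≤ L := by
    have := Real.log_two_lt_d9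
    linarith
  have hT0 : 0 ≤ T := by positivity
  set a := κ + ((q : ℝ) - (j + 1 : ℕ)) * (p + 1) with ha
  have ha0 : 0 ≤ a := by
    have : 0 ≤ (q : ℝ) - (j + 1 : ℕ) := by linarith
    positivity
  have haK : a ≤ κ + q * (p + 1) := by
    rw [ha]
    gcongr
    linarith [Nat.cast_nonneg (α := ℝ) (j + 1)]
  constructor
  · calc T * (a * y) = a * (T * y) := by ring
      _ ≤ (κ + q * (p + 1)) * (2 * L ^ (1 - 1 / (q : ℝ))) := by gcongr
      _ = _ := by ring
  -- The coefficient gains `p + 1` from `j + 1` to `j`, which pays for `p * L + log 2`.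
  · have h2 : κ + ((q : ℝ) - j) * (p + 1) = a + (p + 1) := by
      rw [ha]; push_cast; ring
    rw [h2]
    have h3 : T * (a * y) ≤ T * (a * z) := by gcongr
    have h4 : ((p : ℝ) + 1) * L ≤ (p + 1) * (T * z) := by gcongr
    calc p * L + Real.log 2 + T * (a * y) ≤ (p + 1) * (T * z) + T * (a * z) := by linarith
      _ = _ := by ring

open Finset in
theorem lemma3p5 (d : ℝ) (hd : 0 < d) (p q : ℕ) (hp : 2 ≤ p) (hq : 2 ≤ q) :
    ∃ C ε : ℝ, 0 < C ∧ 0 < ε ∧ ∀ η : ℝ, 0 < η → ∃ n₀ : ℕ, ∀ n : ℕ, n₀ ≤ n →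
      ∀ (V : Type*) [Fintype V] [DecidableEq V] (G : SimpleGraph V),
        Fintype.card V = n →
        (G.cliqueIndepNum p : ℝ) <
          (n : ℝ) ^ (1 - C * Real.log (n : ℝ) ^ (-(1 / (q : ℝ)))) →
        ∀ U : Fin q → Finset V,
          (∀ i j : Fin q, i ≠ j → Disjoint (U i) (U j)) →
          (∀ i : Fin q, η * (n : ℝ) ≤ ((U i).card : ℝ)) →
          (∀ i j : Fin q, i ≠ j → G.IsRegularPair ε d (U i) (U j)) →
          ∃ S : Finset V, G.IsNClique (p * q) S ∧ ∀ i : Fin q, (S ∩ U i).card = p := by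
  obtain ⟨ε', c, hε', hc, hcount⟩ :=
    SimpleGraph.exists_card_transversal_cliques_ge (d / 2) (by positivity) q
  -- Chosen so that the initial density `exp (-x q) = exp (-κ)` is at most `c`.
  set κ : ℝ := max 0 (-Real.log c) with hκ
  have hκ0 : 0 ≤ κ := le_max_left _ _
  have hκc : Real.exp (-κ) ≤ c := by
    rw [← Real.le_log_iff_exp_le hc]
    linarith [le_max_right 0 (-Real.log c)]
  have hq0 : 0 < q := by omega
  have hq0' : (0 : ℝ) < q := by exact_mod_cast hq0
  -- The extra `+ 1` in `C` absorbs the constant `η / 2` for large `n`; `ε ≤ d / 2` leaves density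
  -- `d / 2` in large subpairs.
  refine ⟨2 * (κ + q * (p + 1)) + 1, min ε' (d / 2), by positivity, by positivity, fun η hη => ?_⟩
  have hexp : (0 : ℝ) < 1 - 1 / (q : ℝ) := by
    rw [sub_pos, div_lt_one hq0']
    exact_mod_cast hq
  have hlim : Filter.Tendsto (fun n : ℕ => Real.log (n : ℝ)) Filter.atTop Filter.atTop :=
    Real.tendsto_log_atTop.comp tendsto_natCast_atTop_atTop
  obtain ⟨n₀, hn₀⟩ := Filter.eventually_atTop.1 ((Filter.eventually_gt_atTop 0).and
    ((hlim.eventually_ge_atTop 1).and (((tendsto_rpow_atTop hexp).comp hlim).eventually_ge_atTop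
      (Real.log (2 / η)))))
  refine ⟨n₀, fun n hn V _ _ G hVn hα U hdisj hUη hreg => ?_⟩
  classical
  obtain ⟨hn0, hL, hη'⟩ := hn₀ n hn
  simp only [Function.comp] at hη'
  have hn0' : (0 : ℝ) < n := by exact_mod_cast hn0
  set L := Real.log (n : ℝ) with hLdef
  have hL0 : 0 < L := by linarith
  have hUpos : ∀ i, (0 : ℝ) < #(U i) := fun i => lt_of_lt_of_le (by positivity) (hUη i)
  have hUn : ∀ i, (#(U i) : ℝ) ≤ n := fun i => by rw [← hVn]; exact_mod_cast card_le_univ _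
  have hnexp : (n : ℝ) = Real.exp L := (Real.exp_log hn0').symm
  set M := κ + q * (p + 1) with hM
  have hg : (n : ℝ) ^ (1 - (2 * M + 1) * L ^ (-(1 / (q : ℝ)))) =
      n * Real.exp (-((2 * M + 1) * L ^ (1 - 1 / (q : ℝ)))) := by
    rw [Real.rpow_def_of_pos hn0', ← hLdef, mul_sub, mul_one, sub_eq_add_neg, Real.exp_add,
      ← hnexp, sub_eq_add_neg 1 (1 / (q : ℝ)), Real.rpow_add hL0, Real.rpow_one]
    congr 3
    ring
  set m := (n : ℝ) ^ (1 - (2 * M + 1) * L ^ (-(1 / (q : ℝ)))) with hm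
  let x : ℕ → ℝ := fun k => (κ + ((q : ℝ) - k) * (p + 1)) * L ^ (1 - (k : ℝ) / q)
  let t : ℕ → ℕ := fun j => ⌈L ^ ((j : ℝ) / q)⌉₊
  have hpar : ∀ j < q, (t j : ℝ) * x (j + 1) ≤ 2 * M * L ^ (1 - 1 / (q : ℝ)) ∧
      p * L + Real.log 2 + (t j : ℝ) * x (j + 1) ≤ (t j : ℝ) * x j :=
    fun j hj => drc_parameters κ hκ0 p q hq0 hL hj
  have hxq : x q = κ := by simp [x, div_self hq0'.ne']
  have hδpow : ∀ k s : ℕ, Real.exp (-x k) ^ s = Real.exp (-(s * x k)) := fun k s => by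
    rw [← Real.exp_nat_mul]; congr 1; ring
  have hreg' : ∀ i j, i ≠ j → G.IsLowerRegular ε' (d / 2) (U i) (U j) := fun i j hij => by
    intro X hX Y hY hX' hY'
    have hmin : min ε' (d / 2) ≤ ε' := min_le_left _ _
    refine le_trans ?_ ((hreg i j hij).isLowerRegular X hX Y hY (le_trans ?_ hX')
      (le_trans ?_ hY'))
    · have : d / 2 ≤ d - min ε' (d / 2) := by linarith [min_le_right ε' (d / 2)]
      rw [mul_assoc, mul_assoc]
      exact mul_le_mul_of_nonneg_right this (mul_nonneg (Nat.cast_nonneg _) (Nat.cast_nonneg _))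
    · exact mul_le_mul_of_nonneg_right hmin (Nat.cast_nonneg _)
    · exact mul_le_mul_of_nonneg_right hmin (Nat.cast_nonneg _)
  obtain ⟨S, hS, hSF⟩ := exists_piFinset_subset (fun S => G.IsClique (S : Set V)) p m
    (fun A hA => by
      obtain ⟨S, hSA, hS⟩ := G.exists_isNClique_of_cliqueIndepNum_lt (p := p) (A := A)
        (by exact_mod_cast hα.trans_le hA)
      exact ⟨S, hSA, hS.card_eq, hS.isClique⟩)
    (fun k => Real.exp (-x k)) (fun k => Real.exp_pos _) t q U
    (fun i => card_pos.1 (by exact_mod_cast hUpos i))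
    (fun i j hj => by
      rw [hδpow, hδpow]
      calc (#(U i) : ℝ) ^ p * Real.exp (-(t j * x j)) ≤ (n : ℝ) ^ p * Real.exp (-(t j * x j)) := by
            exact mul_le_mul_of_nonneg_right (pow_le_pow_left₀ (Nat.cast_nonneg _) (hUn i) p)
              (Real.exp_pos _).le
        _ = Real.exp (p * L - t j * x j) := by
            rw [hnexp, ← Real.exp_nat_mul, ← Real.exp_add, sub_eq_add_neg]
        _ ≤ Real.exp (-(t j * x (j + 1)) - Real.log 2) :=
            Real.exp_le_exp.2 (by linarith [(hpar j hj).2])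
        _ = _ := by rw [Real.exp_sub, Real.exp_log two_pos])
    (fun i j hj => by
      rw [hδpow, hg]
      set w := L ^ (1 - 1 / (q : ℝ)) with hw
      have h1 : Real.exp (-w) ≤ η / 2 := by
        rw [← Real.le_log_iff_exp_le (by positivity)]
        have : Real.log (η / 2) = - Real.log (2 / η) := by rw [← Real.log_inv, inv_div]
        linarith
      calc (n : ℝ) * Real.exp (-((2 * M + 1) * w))
          = Real.exp (-(2 * M * w)) * Real.exp (-w) * n := by
            rw [← Real.exp_add, mul_comm]; congr 2; ring
        _ ≤ Real.exp (-(t j * x (j + 1))) * (η / 2) * n := by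
            have h2 := Real.exp_le_exp.2 (neg_le_neg (hpar j hj).1)
            gcongr
        _ = Real.exp (-(t j * x (j + 1))) / 2 * (η * n) := by ring
        _ ≤ _ := mul_le_mul_of_nonneg_left (hUη i) (by positivity))
    {f ∈ Fintype.piFinset U | ∀ i j, i ≠ j → G.Adj (f i) (f j)} (filter_subset _ _)
    (by
      refine le_trans ?_ (hcount V G U hreg')
      rw [hxq]
      exact mul_le_mul_of_nonneg_right hκc (prod_nonneg fun i _ => Nat.cast_nonneg _))
  have hSdisj : ∀ i j, i ≠ j → Disjoint (S i) (S j) := fun i j hij =>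
    disjoint_of_subset_left (hS i).1 (disjoint_of_subset_right (hS j).1 (hdisj i j hij))
  refine ⟨univ.biUnion S, G.isNClique_biUnion_of_piFinset (by omega)
    (fun i => ⟨(hS i).2.2, (hS i).2.1⟩) hSdisj fun f hf => (mem_filter.1 (hSF hf)).2, fun i => ?_⟩
  have : univ.biUnion S ∩ U i = S i := by
    ext v
    simp only [mem_inter, mem_biUnion, mem_univ, true_and]
    constructor
    · rintro ⟨⟨j, hj⟩, hv⟩
      by_cases hij : j = i
      · exact hij ▸ hj
      · exact absurd hv (disjoint_left.1 (hdisj j i hij) ((hS j).1 hj))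
    · exact fun hv => ⟨⟨i, hv⟩, (hS i).1 hv⟩
  rw [this, (hS i).2.1]
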